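/- Let $\Bbbk$ be a field and let $B$ be a $\Bbbk$-bialgebra with comultiplication $\Delta$ and counit $\varepsilon$. Put $B^+=\ker\varepsilon$, let $B$ act on $B\otimes B$ from the right by $(x\otimes y)\cdot b=(x\otimes y)\Delta(b)$, and set $B\oslash B=(B\otimes B)/(B\otimes B)B^+$. Let $i_B\colon B\to B\oslash B$ be the linear map sending $x$ to the class of $x\otimes 1$. The subspace $\ker(i_B)B$ spanned by the products $xb$ with $x\in\ker(i_B)$ and $b\in B$ is a two-sided ideal and a coideal of $B$; let $Q(B)=B/\ker(i_B)B$ be the quotient bialgebra and $q_B\colon B\to Q(B)$ the canonical projection. Theorem. Suppose that $B$ is right perfect as an algebra, that is, $B$ satisfies the descending chain condition on principal left ideals. Then $\mathrm{H}(B)=Q(B)$: the bialgebra $Q(B)$ together with $q_B$ is the Hopf envelope (the free Hopf algebra) of $B$. In other words, $Q(B)$ is a Hopf algebra, and for every Hopf algebra $L$ over $\Bbbk$ and every bialgebra map $f\colon B\to L$ there is a unique Hopf algebra map $g\colon Q(B)\to L$ with $g\circ q_B=f$. -/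

import Mathlib

open TensorProduct Coalgebra

universe u v v' w

/-- A ring `R` is right perfect: it satisfies the descending chain condition on
principal *left* ideals (in Mathlib, `Ideal R` is the type of left ideals). By Bass' theorem this is
the same as asking that every right `R`-module has a projective cover; there is no mistake in the
change of side. -/
def IsRightPerfect (R : Type v) [Ring R] : Prop :=
  ∀ a : ℕ → R, Antitone (fun n => Ideal.span {a n}) →
    ∃ n, ∀ m, n ≤ m → Ideal.span {a m} = Ideal.span {a n}

section Envelope

variable (k : Type u) [Field k] (B : Type v) [Ring B] [Bialgebra k B]

/-- The subspace `(B ⊗ B) B⁺` of `B ⊗ B`, where `B⁺` is the kernel of the counit and `b ∈ B` acts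
on the right of `B ⊗ B` diagonally: `(x ⊗ y) · b = x b₁ ⊗ y b₂ = (x ⊗ y) Δ(b)`. -/
def oslashRel : Submodule k (B ⊗[k] B) :=
  Submodule.span k {z | ∃ (t : B ⊗[k] B) (b : B), counit (R := k) b = 0 ∧ z = t * comul (R := k) b}

/-- The vector space `B ⊘ B = (B ⊗ B) / (B ⊗ B) B⁺`. -/
abbrev Oslash : Type v := (B ⊗[k] B) ⧸ oslashRel k B

/-- The canonical map `i_B : B → B ⊘ B`, sending `x` to the class of `x ⊗ 1`. -/
def iMap : B →ₗ[k] Oslash k B :=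
  (oslashRel k B).mkQ ∘ₗ (TensorProduct.mk k B B).flip 1

variable {k B} in
theorem mul_mem_oslashRel (s : B ⊗[k] B) {z : B ⊗[k] B} (hz : z ∈ oslashRel k B) :
    s * z ∈ oslashRel k B := by
  refine Submodule.span_induction ?_ ?_ ?_ ?_ hz
  · rintro _ ⟨t, b, hb, rfl⟩
    exact Submodule.subset_span ⟨s * t, b, hb, (mul_assoc _ _ _).symm⟩
  · simp
  · intro x y _ _ hx hy
    rw [mul_add]
    exact add_mem hx hy
  · intro c x _ hx
    rw [mul_smul_comm]
    exact Submodule.smul_mem _ _ hx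

variable {k B} in
theorem mul_mem_ker_iMap (a : B) {x : B} (hx : x ∈ LinearMap.ker (iMap k B)) :
    a * x ∈ LinearMap.ker (iMap k B) := by
  simp only [iMap, LinearMap.mem_ker, LinearMap.comp_apply, LinearMap.flip_apply,
    TensorProduct.mk_apply, Submodule.mkQ_apply, Submodule.Quotient.mk_eq_zero] at hx ⊢
  simpa using mul_mem_oslashRel (a ⊗ₜ[k] (1 : B)) hx

/-- `ker(i_B) B`: the set of finite sums of products `x b` with `x ∈ ker(i_B)` and `b ∈ B`.
It is a left ideal because `ker(i_B)` is one. -/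
def kerIdeal : Ideal B where
  toAddSubmonoid := (LinearMap.ker (iMap k B) * (⊤ : Submodule k B)).toAddSubmonoid
  smul_mem' c x hx := by
    change x ∈ LinearMap.ker (iMap k B) * (⊤ : Submodule k B) at hx
    change c * x ∈ LinearMap.ker (iMap k B) * (⊤ : Submodule k B)
    refine Submodule.mul_induction_on hx ?_ ?_
    · intro m hm n hn
      rw [← mul_assoc]
      exact Submodule.mul_mem_mul (mul_mem_ker_iMap c hm) hn
    · intro x y hx hy
      rw [mul_add]
      exact add_mem hx hy

variable {k B} in
theorem mem_kerIdeal {x : B} :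
    x ∈ kerIdeal k B ↔ x ∈ LinearMap.ker (iMap k B) * (⊤ : Submodule k B) := Iff.rfl

instance kerIdeal_isTwoSided : (kerIdeal k B).IsTwoSided where
  mul_mem_of_left {a} b ha := by
    rw [mem_kerIdeal] at ha ⊢
    refine Submodule.mul_induction_on ha ?_ ?_
    · intro m hm n _
      rw [mul_assoc]
      exact Submodule.mul_mem_mul hm Submodule.mem_top
    · intro x y hx hy
      rw [add_mul]
      exact add_mem hx hy

/-- The algebra map `x ⊗ y ↦ (x₁ ⊗ y₂) ⊗ (x₂ ⊗ y₁)`: the comultiplication of `B ⊗ B^cop`. -/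
def copComul : B ⊗[k] B →ₐ[k] (B ⊗[k] B) ⊗[k] (B ⊗[k] B) :=
  (Algebra.TensorProduct.tensorTensorTensorComm k k k k B B B B).toAlgHom.comp
    (Algebra.TensorProduct.map (Bialgebra.comulAlgHom k B)
      ((Algebra.TensorProduct.comm k B B).toAlgHom.comp (Bialgebra.comulAlgHom k B)))

variable {k B} in
theorem mkQ_mul_comul (t : B ⊗[k] B) (b : B) :
    (oslashRel k B).mkQ (t * comul (R := k) b) = counit (R := k) b • (oslashRel k B).mkQ t := by
  have h : t * comul (R := k) (b - algebraMap k B (counit (R := k) b)) ∈ oslashRel k B :=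
    Submodule.subset_span ⟨t, _, by simp, rfl⟩
  rw [← map_smul, ← sub_eq_zero, ← map_sub, Submodule.mkQ_apply, Submodule.Quotient.mk_eq_zero]
  convert h using 1
  rw [map_sub, mul_sub, Bialgebra.comul_algebraMap, Algebra.algebraMap_eq_smul_one, mul_smul_comm,
    mul_one]

variable {k B} in
theorem four_comul :
    TensorProduct.map (comul (R := k) (A := B)) comul ∘ₗ comul =
      (TensorProduct.assoc k B B (B ⊗[k] B)).symm.toLinearMap ∘ₗ
        LinearMap.lTensor B ((TensorProduct.assoc k B B B).toLinearMap ∘ₗ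
          LinearMap.rTensor B comul ∘ₗ comul) ∘ₗ comul := by
  simp only [coassoc_simps]

/-- The linear map `x ⊗ (u ⊗ z) ↦ (x ⊗ z) ⊗ u`. -/
def outerPair (M : Type v) [AddCommGroup M] [Module k M] :
    B ⊗[k] (M ⊗[k] B) →ₗ[k] (B ⊗[k] B) ⊗[k] M :=
  (TensorProduct.assoc k B B M).symm.toLinearMap ∘ₗ
    LinearMap.lTensor B (TensorProduct.comm k M B).toLinearMap

variable {k B} in
theorem copComul_comul (b : B) :
    copComul k B (comul b) = outerPair k B (B ⊗[k] B)
      (LinearMap.lTensor B (LinearMap.rTensor B comul ∘ₗ comul) (comul b)) := by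
  have h1 : ∀ z : B ⊗[k] B, copComul k B z =
    TensorProduct.tensorTensorTensorComm k B B B B
      (LinearMap.lTensor (B ⊗[k] B) (TensorProduct.comm k B B).toLinearMap
        (TensorProduct.map comul comul z)) := by
    intro z
    induction z with
    | zero => simp
    | tmul x y => rfl
    | add x y hx hy => simp [hx, hy]
  have h2 : ∀ z : B ⊗[k] ((B ⊗[k] B) ⊗[k] B),
    TensorProduct.tensorTensorTensorComm k B B B B
      (LinearMap.lTensor (B ⊗[k] B) (TensorProduct.comm k B B).toLinearMap
        ((TensorProduct.assoc k B B (B ⊗[k] B)).symm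
          (LinearMap.lTensor B (TensorProduct.assoc k B B B).toLinearMap z))) =
      outerPair k B (B ⊗[k] B) z := by
    intro z
    induction z with
    | zero => simp
    | add x y hx hy => simp only [map_add, hx, hy]
    | tmul x y =>
      induction y with
      | zero => simp
      | add y y' hy hy' => simp only [TensorProduct.tmul_add, map_add, hy, hy']
      | tmul u d =>
        induction u with
        | zero => simp
        | add y y' hy hy' =>
          simp only [TensorProduct.tmul_add, TensorProduct.add_tmul, map_add, hy, hy']
        | tmul y z => rfl
  rw [h1, ← h2]
  have h3 := LinearMap.congr_fun (four_comul (k := k) (B := B)) b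
  simp only [LinearMap.comp_apply] at h3
  rw [h3, LinearMap.lTensor_comp]
  rfl

variable {k B} in
theorem map_mkQ_mul_copComul (w : (B ⊗[k] B) ⊗[k] (B ⊗[k] B)) (b : B) :
    TensorProduct.map (oslashRel k B).mkQ (oslashRel k B).mkQ (w * copComul k B (comul b)) =
      counit (R := k) b • TensorProduct.map (oslashRel k B).mkQ (oslashRel k B).mkQ w := by
  have h1 : ∀ (w : (B ⊗[k] B) ⊗[k] (B ⊗[k] B)) (z : B ⊗[k] (B ⊗[k] B)),
      TensorProduct.map (oslashRel k B).mkQ (oslashRel k B).mkQ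
        (w * outerPair k B (B ⊗[k] B) (LinearMap.lTensor B (LinearMap.rTensor B comul) z)) =
      TensorProduct.map (oslashRel k B).mkQ (oslashRel k B).mkQ
        (w * ((LinearMap.lTensor B ((TensorProduct.lid k B).toLinearMap ∘ₗ
          LinearMap.rTensor B counit) z) ⊗ₜ[k] 1)) := by
    intro w z
    induction z with
    | zero => simp
    | add x y hx hy => simp only [map_add, mul_add, TensorProduct.add_tmul, hx, hy]
    | tmul x y =>
      induction y with
      | zero => simp
      | add y y' hy hy' =>
        simp only [TensorProduct.tmul_add, map_add, mul_add, TensorProduct.add_tmul, hy, hy']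
      | tmul y d =>
        induction w with
        | zero => simp
        | add w w' hw hw' => simp only [add_mul, map_add, hw, hw']
        | tmul u v =>
          have e1 : outerPair k B (B ⊗[k] B) (LinearMap.lTensor B (LinearMap.rTensor B comul)
              (x ⊗ₜ[k] (y ⊗ₜ[k] d))) = (x ⊗ₜ[k] d) ⊗ₜ[k] comul y := rfl
          have e2 : LinearMap.lTensor B ((TensorProduct.lid k B).toLinearMap ∘ₗ
              LinearMap.rTensor B counit) (x ⊗ₜ[k] (y ⊗ₜ[k] d)) =
              counit (R := k) y • (x ⊗ₜ[k] d) := by simp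
          rw [e1, e2, Algebra.TensorProduct.tmul_mul_tmul, Algebra.TensorProduct.tmul_mul_tmul,
            TensorProduct.map_tmul, TensorProduct.map_tmul, mkQ_mul_comul, mul_one,
            mul_smul_comm, map_smul, TensorProduct.smul_tmul]
  have h2 : LinearMap.lTensor B ((TensorProduct.lid k B).toLinearMap ∘ₗ
      LinearMap.rTensor B counit) (LinearMap.lTensor B comul (comul b)) = comul (R := k) b := by
    rw [← LinearMap.comp_apply, ← LinearMap.lTensor_comp, LinearMap.comp_assoc,
      Coalgebra.rTensor_counit_comp_comul]
    have : (TensorProduct.lid k B).toLinearMap ∘ₗ TensorProduct.mk k k B 1 = LinearMap.id := by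
      ext; simp
    rw [this, LinearMap.lTensor_id, LinearMap.id_apply]
  rw [copComul_comul, LinearMap.lTensor_comp, LinearMap.comp_apply, h1, h2]
  induction w with
  | zero => simp
  | add w w' hw hw' => simp only [add_mul, map_add, hw, hw', smul_add]
  | tmul u v =>
    rw [Algebra.TensorProduct.tmul_mul_tmul, TensorProduct.map_tmul, mkQ_mul_comul,
      mul_one, TensorProduct.map_tmul, TensorProduct.smul_tmul']

variable {k B} in
theorem map_iMap_comul_eq_zero {x : B} (hx : x ∈ LinearMap.ker (iMap k B)) :
    TensorProduct.map (iMap k B) (iMap k B) (comul x) = 0 := by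
  have h0 : ∀ z ∈ oslashRel k B, TensorProduct.map (oslashRel k B).mkQ (oslashRel k B).mkQ
      (copComul k B z) = 0 := by
    intro z hz
    refine Submodule.span_induction ?_ ?_ ?_ ?_ hz
    · rintro _ ⟨t, b, hb, rfl⟩
      rw [map_mul, map_mkQ_mul_copComul, hb, zero_smul]
    · simp
    · intro x y _ _ hx hy
      rw [map_add, map_add, hx, hy, add_zero]
    · intro c x _ hx
      rw [map_smul, map_smul, hx, smul_zero]
  have h1 : x ⊗ₜ[k] (1 : B) ∈ oslashRel k B := by
    simpa [iMap] using hx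
  have h2 : ∀ z : B ⊗[k] B, TensorProduct.map (iMap k B) (iMap k B) z =
      TensorProduct.map (oslashRel k B).mkQ (oslashRel k B).mkQ
        (TensorProduct.tensorTensorTensorComm k B B B B (z ⊗ₜ[k] (1 ⊗ₜ[k] 1))) := by
    intro z
    induction z with
    | zero => simp
    | add w w' hw hw' => simp only [TensorProduct.add_tmul, map_add, hw, hw']
    | tmul u v => rfl
  rw [h2, ← h0 _ h1]
  congr 1
  simp only [copComul, AlgHom.comp_apply,
    Algebra.TensorProduct.map_tmul, map_one, Algebra.TensorProduct.one_def]
  rfl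

variable {k B} in
theorem counit_eq_zero_of_mem_ker {x : B} (hx : x ∈ LinearMap.ker (iMap k B)) :
    counit (R := k) x = 0 := by
  have h0 : ∀ z ∈ oslashRel k B, counit (R := k) z = 0 := by
    intro z hz
    refine Submodule.span_induction ?_ ?_ ?_ ?_ hz
    · rintro _ ⟨t, b, hb, rfl⟩
      have : counit (R := k) (comul (R := k) b) = counit (R := k) b := by
        have h := congrArg (counit (R := k)) (Coalgebra.rTensor_counit_comul (R := k) b)
        rw [← LinearMap.comp_apply] at h
        have e : counit (R := k) ∘ₗ LinearMap.rTensor B (counit (R := k)) =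
            (counit (R := k) : B ⊗[k] B →ₗ[k] k) := by
          ext; simp
        rw [e] at h
        simpa using h
      rw [Bialgebra.counit_mul, this, hb, mul_zero]
    · simp
    · intro x y _ _ hx hy
      rw [map_add, hx, hy, add_zero]
    · intro c x _ hx
      rw [map_smul, hx, smul_zero]
  have h1 : x ⊗ₜ[k] (1 : B) ∈ oslashRel k B := by
    simpa [iMap] using hx
  simpa using h0 _ h1

instance kerIdeal_isCoideal : ((kerIdeal k B).restrictScalars k).IsCoideal where
  counit_eq_zero x hx := by
    refine Submodule.mul_induction_on (mem_kerIdeal.1 hx) ?_ ?_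
    · intro m hm n _
      rw [Bialgebra.counit_mul, counit_eq_zero_of_mem_ker hm, zero_mul]
    · intro x y hx hy
      rw [map_add, hx, hy, add_zero]
  map_mkQ_comul_eq_zero x hx := by
    set q := Ideal.Quotient.mkₐ k (kerIdeal k B) with hq
    change Algebra.TensorProduct.map q q (comul x) = 0
    have key : ∀ y ∈ LinearMap.ker (iMap k B), Algebra.TensorProduct.map q q (comul y) = 0 := by
      intro y hy
      obtain ⟨g, hg⟩ : ∃ g : Oslash k B →ₗ[k] B ⧸ kerIdeal k B,
          g ∘ₗ iMap k B = q.toLinearMap := by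
        have hle : LinearMap.ker (iMap k B) ≤ LinearMap.ker q.toLinearMap := by
          intro z hz
          have : z ∈ kerIdeal k B := by
            rw [mem_kerIdeal, ← mul_one z]
            exact Submodule.mul_mem_mul hz Submodule.mem_top
          simpa [hq, Ideal.Quotient.eq_zero_iff_mem] using this
        obtain ⟨g, hg⟩ := LinearMap.exists_extend
          ((LinearMap.ker (iMap k B)).liftQ q.toLinearMap hle ∘ₗ
            (iMap k B).quotKerEquivRange.symm.toLinearMap)
        refine ⟨g, LinearMap.ext fun z => ?_⟩
        have h := LinearMap.congr_fun hg ⟨iMap k B z, z, rfl⟩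
        rw [LinearMap.comp_apply, LinearMap.comp_apply, LinearEquiv.coe_coe,
          LinearMap.quotKerEquivRange_symm_apply_image (iMap k B) z ⟨z, rfl⟩] at h
        simpa using h
      change TensorProduct.map q.toLinearMap q.toLinearMap (comul y) = 0
      rw [← hg, TensorProduct.map_comp, LinearMap.comp_apply, map_iMap_comul_eq_zero hy, map_zero]
    refine Submodule.mul_induction_on (mem_kerIdeal.1 hx) ?_ ?_
    · intro m hm n _
      rw [Bialgebra.comul_mul, map_mul, key m hm, zero_mul]
    · intro x y hx hy
      rw [map_add, map_add, hx, hy, add_zero]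

/-- The bialgebra `Q(B) = B / ker(i_B) B`, with the quotient bialgebra structure. -/
abbrev QBialg : Type v := B ⧸ kerIdeal k B

/-- The canonical projection `q_B : B → Q(B)`, a bialgebra map. -/
def qMap : B →ₐc[k] QBialg k B := Bialgebra.Quotient.mkBialgHom (kerIdeal k B)

end Envelope

section HopfEnvelope

variable (k : Type u) [Field k]

/-- `S` is an antipode of the bialgebra `H`: `S(x₁) x₂ = ε(x) 1 = x₁ S(x₂)`. -/
def IsAntipode {H : Type v} [Ring H] [Bialgebra k H] (S : H →ₗ[k] H) : Prop :=
  LinearMap.mul' k H ∘ₗ S.rTensor H ∘ₗ comul = Algebra.linearMap k H ∘ₗ counit ∧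
    LinearMap.mul' k H ∘ₗ S.lTensor H ∘ₗ comul = Algebra.linearMap k H ∘ₗ counit

/-- The bialgebra `H` together with the bialgebra map `η : B → H` is a Hopf envelope of `B` (the
free Hopf algebra generated by `B`): `H` has an antipode, i.e. is a Hopf algebra, and for every
bialgebra map `f : B → L` to a Hopf algebra `L` there is a unique Hopf algebra map `g : H → L`
(a bialgebra map which commutes with the antipodes) with `g ∘ η = f`. -/
def IsHopfEnvelope {B : Type v} [Ring B] [Bialgebra k B] {H : Type v'} [Ring H] [Bialgebra k H]
    (η : B →ₐc[k] H) : Prop :=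
  ∃ S : H →ₗ[k] H, IsAntipode k S ∧
    ∀ (L : Type w) [Ring L] [HopfAlgebra k L] (f : B →ₐc[k] L),
      ∃! g : H →ₐc[k] L,
        (∀ x, g (S x) = HopfAlgebra.antipode k (g x)) ∧ g.comp η = f

end HopfEnvelope

/-!
The universal property comes from the map `B ⊘ B → L`, `[x ⊗ y] ↦ f(x) S(f(y))`, for a bialgebra map
`f : B → L` to a Hopf algebra: it shows that `f` kills `ker(i_B)`, hence factors through `Q(B)`
(`map_eq_zero_of_mem_ker_iMap`, `exists_comp_qMap_eq`). Uniqueness is clear, and bialgebra maps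
commute with antipodes. What has to be proved is that `Q(B)` has an antipode.

Right perfectness enters through the following fact (`IsRightPerfect.exists_convPow_eqOn`). Let
`f : C → A` be a linear map from a coalgebra to a right perfect algebra, and let `V` be a
finite-dimensional right coideal of `C`. Then `Hom(V, A)` is a finitely generated left `A`-module,
and the images of `- * fⁿ` form a descending chain of finitely generated submodules. By Björk's
theorem (`IsRightPerfect.acc_of_fg`) this chain has two equal consecutive terms, so `fⁿ = g * fⁿ⁺¹`
on `V` for some `n` and some `g`. Every element of `C` lies in such a `V`.

With `f = id_B`, this yields `[1 ⊗ y] = [g(y) ⊗ 1]` in `B ⊘ B`: modulo `(B ⊗ B) B⁺` a factor `b₁ ⊗ b₂`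
may be inserted between `x` and `y` in `x ⊗ y`, so that, computing in `B ⊗ Bᵒᵖ`, one can pass from
`1 ⊗ y` to `idⁿ ⊗ idⁿ⁺¹ = g * idⁿ⁺¹ ⊗ idⁿ⁺¹` and back to `g ⊗ 1`. Hence `i_B` is surjective
(`IsRightPerfect.iMap_surjective`), and `S(y) = q_B(s)`, where `[s ⊗ 1] = [1 ⊗ y]`, is a right
convolution inverse of `q_B` (`exists_qMap_convMul_eq_one`).

With `f` the identity of `Q(B)`, which is again right perfect, the fact gives `qⁿ = (g ∘ q) * qⁿ⁺¹`
locally on `B`, where `q = q_B`. Multiplying by powers of `S` on the right, `1 = (g ∘ q) * q` and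
`S = g ∘ q`. So `S` is also a left inverse of `q_B`, it vanishes on `ker(q_B)`, and it induces an
antipode of `Q(B)` (`IsRightPerfect.exists_isAntipode`).
-/

/-! ### Descending chains over right perfect rings -/

section RightPerfect

variable {R : Type*} [Ring R]

theorem IsRightPerfect.of_surjective {R : Type*} {R' : Type*} [Ring R] [Ring R']
    (hR : IsRightPerfect R) (φ : R →+* R') (hφ : Function.Surjective φ) : IsRightPerfect R' := by
  intro a ha
  have hmem : ∀ n, ∃ r : R, φ r * a n = a (n + 1) := by
    intro n
    obtain ⟨r', hr'⟩ := Ideal.mem_span_singleton'.1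
      (ha n.le_succ (Ideal.mem_span_singleton_self (a (n + 1))))
    obtain ⟨r, rfl⟩ := hφ r'
    exact ⟨r, hr'⟩
  choose r hr using hmem
  let b : ℕ → R := fun n => Nat.rec 1 (fun n x => r n * x) n
  have hb : ∀ n, φ (b n) * a 0 = a n := by
    intro n
    induction n with
    | zero => simp [b]
    | succ n ih => rw [← hr n, ← ih, ← mul_assoc, ← map_mul]
  obtain ⟨n, hn⟩ := hR b (antitone_nat_of_succ_le fun n =>
    (Ideal.span_singleton_le_iff_mem _).2 (Ideal.mem_span_singleton'.2 ⟨r n, rfl⟩))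
  refine ⟨n, fun m hm => le_antisymm (ha hm) ?_⟩
  obtain ⟨s, hs⟩ := Ideal.mem_span_singleton'.1
    ((hn m hm).symm ▸ Ideal.mem_span_singleton_self (b n) : b n ∈ Ideal.span {b m})
  refine (Ideal.span_singleton_le_iff_mem _).2 (Ideal.mem_span_singleton'.2 ⟨φ s, ?_⟩)
  rw [← hb m, ← hb n, ← hs, map_mul, mul_assoc]

variable {M : Type*} [AddCommGroup M] [Module R M]

/-- The chain condition on principal left ideals passes to the cyclic submodules of any left module:
a descending chain of cyclic submodules is generated by `rₙ⋯r₁x`, for suitable `rᵢ`, and the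
left ideals generated by `rₙ⋯r₁` form a descending chain. -/
theorem IsRightPerfect.wellFounded_span_singleton (hR : IsRightPerfect R) :
    WellFounded fun x y : M => Submodule.span R {x} < Submodule.span R {y} := by
  rw [wellFounded_iff_isEmpty_descending_chain]
  refine ⟨fun ⟨x, hx⟩ => ?_⟩
  have hmem : ∀ n, ∃ r : R, r • x n = x (n + 1) := fun n =>
    Submodule.mem_span_singleton.1 ((hx n).le (Submodule.mem_span_singleton_self (x (n + 1))))
  choose r hr using hmem
  let b : ℕ → R := fun n => Nat.rec 1 (fun n x => r n * x) n
  have hb : ∀ n, b n • x 0 = x n := by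
    intro n
    induction n with
    | zero => simp [b]
    | succ n ih => rw [← hr n, ← ih, ← mul_smul]
  obtain ⟨n, hn⟩ := hR b (antitone_nat_of_succ_le fun n =>
    (Ideal.span_singleton_le_iff_mem _).2 (Ideal.mem_span_singleton'.2 ⟨r n, rfl⟩))
  obtain ⟨s, hs⟩ := Ideal.mem_span_singleton'.1
    ((hn (n + 1) n.le_succ).symm ▸ Ideal.mem_span_singleton_self (b n) :
      b n ∈ Ideal.span {b (n + 1)})
  refine (hx n).not_ge ((Submodule.span_singleton_le_iff_mem _ _).2
    (Submodule.mem_span_singleton.2 ⟨s, ?_⟩))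
  rw [← hb (n + 1), smul_smul, hs, hb n]

theorem IsRightPerfect.exists_minimal_span_singleton (hR : IsRightPerfect R) {s : Set M}
    (hs : s.Nonempty) :
    ∃ y ∈ s, ∀ z ∈ s, z ∈ Submodule.span R {y} → y ∈ Submodule.span R {z} := by
  obtain ⟨y, hy, hmin⟩ := hR.wellFounded_span_singleton.has_min s hs
  refine ⟨y, hy, fun z hz hzy => ?_⟩
  by_contra hyz
  exact hmin z hz (lt_of_le_not_ge ((Submodule.span_singleton_le_iff_mem _ _).2 hzy)
    fun h => hyz ((Submodule.span_singleton_le_iff_mem _ _).1 h))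

theorem Submodule.FG.exists_eq_span_singleton_sup {L G : Submodule R M} (hL : L.FG) {y : M}
    (hy : y ∈ L) (hLG : L ≤ span R {y} ⊔ G) :
    ∃ F : Submodule R M, F.FG ∧ F ≤ G ∧ L = span R {y} ⊔ F := by
  obtain ⟨s, rfl⟩ := hL
  have h : ∀ g : s, ∃ f ∈ G, ∃ t : R, t • y + f = g := by
    intro g
    obtain ⟨a, ha, f, hf, h⟩ := mem_sup.1 (hLG (subset_span g.2))
    obtain ⟨t, rfl⟩ := mem_span_singleton.1 ha
    exact ⟨f, hf, t, h⟩
  choose f hf t ht using h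
  refine ⟨span R (Set.range f), fg_span (Set.finite_range f), ?_, le_antisymm ?_ (sup_le ?_ ?_)⟩
  · rw [span_le]
    rintro _ ⟨g, rfl⟩
    exact hf g
  · rw [span_le]
    intro g hg
    have := ht ⟨g, hg⟩
    simp only at this
    rw [← this]
    exact add_mem (mem_sup_left (smul_mem _ _ (mem_span_singleton_self y)))
      (mem_sup_right (subset_span ⟨_, rfl⟩))
  · rwa [span_singleton_le_iff_mem]
  · rw [span_le]
    rintro _ ⟨g, rfl⟩
    rw [← add_sub_cancel_left (t g • y) (f g), ht g]
    exact sub_mem (subset_span g.2) (smul_mem _ _ hy)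

/-- If every finitely generated submodule of `N` is accessible for strict inclusion among finitely
generated submodules, and `L = Ry + F` with `F ≤ N` and `y` of minimal cyclic span in `L \ N`, then
`L` is accessible. The induction runs over `F`: a smaller `L' ≰ N` is `Ry' + F'` with `F' ≤ F`, and
minimality of `y` forces `L = Ry' + F`, so that `F' ≠ F`. -/
theorem IsRightPerfect.acc_span_singleton_sup (hR : IsRightPerfect R) {N : Submodule R M}
    (hN : ∀ F ≤ N, F.FG → Acc (fun F G : Submodule R M => F.FG ∧ F < G) F)
    {F : Submodule R M} (hF : Acc (fun F G : Submodule R M => F.FG ∧ F < G) F) :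
    F ≤ N → ∀ y ∉ N,
      (∀ z ∈ Submodule.span R {y} ⊔ F, z ∉ N → z ∈ Submodule.span R {y} →
        y ∈ Submodule.span R {z}) →
      Acc (fun F G : Submodule R M => F.FG ∧ F < G) (Submodule.span R {y} ⊔ F) := by
  induction hF with
  | intro F _ ih =>
    intro hFN y hyN hmin
    refine Acc.intro _ fun L ⟨hL, hlt⟩ => ?_
    by_cases hLN : L ≤ N
    · exact hN L hLN hL
    -- `L = Ry' + F'` with `F' ≤ F`, for `y'` of minimal cyclic span in `L \ N`.
    obtain ⟨y', ⟨hy'L, hy'N⟩, hmin'⟩ := hR.exists_minimal_span_singleton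
      (s := {z : M | z ∈ L ∧ z ∉ N}) (Set.not_subset.1 hLN)
    have hy : y ∈ Submodule.span R {y'} ⊔ F := by
      obtain ⟨a, ha, f, hf, rfl⟩ := Submodule.mem_sup.1 (hlt.le hy'L)
      have haN : a ∉ N := fun h => hy'N (add_mem h (hFN hf))
      obtain ⟨s, hs⟩ := Submodule.mem_span_singleton.1
        (hmin a (Submodule.mem_sup_left ha) haN ha)
      have e : y = s • (a + f) - s • f := by rw [smul_add, add_sub_cancel_right, hs]
      rw [e]
      exact sub_mem (Submodule.mem_sup_left
        (Submodule.smul_mem _ _ (Submodule.mem_span_singleton_self _)))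
        (Submodule.mem_sup_right (Submodule.smul_mem _ _ hf))
    have hle : Submodule.span R {y} ⊔ F ≤ Submodule.span R {y'} ⊔ F :=
      sup_le ((Submodule.span_singleton_le_iff_mem _ _).2 hy) le_sup_right
    obtain ⟨F', hF', hF'F, rfl⟩ := hL.exists_eq_span_singleton_sup hy'L (hlt.le.trans hle)
    refine ih F' ⟨hF', lt_of_le_of_ne hF'F ?_⟩ (hF'F.trans hFN) y' hy'N
      fun z hz hzN hzy' => hmin' z ⟨hz, hzN⟩ hzy'
    rintro rfl
    exact hlt.not_ge hle

/-- Björk's theorem: over a ring with the descending chain condition on principal left ideals,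
every left module satisfies the descending chain condition on finitely generated submodules. -/
theorem IsRightPerfect.acc_of_fg (hR : IsRightPerfect R) (F : Submodule R M) (hF : F.FG) :
    Acc (fun F G : Submodule R M => F.FG ∧ F < G) F := by
  obtain ⟨N, hN⟩ := zorn_le₀
    {N : Submodule R M | ∀ F ≤ N, F.FG → Acc (fun F G : Submodule R M => F.FG ∧ F < G) F} (by
      intro c hc hchain
      refine ⟨sSup c, fun F hFc hF => ?_, fun N hN => le_sSup hN⟩
      rcases c.eq_empty_or_nonempty with rfl | hne
      · obtain rfl : F = ⊥ := by simpa using hFc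
        exact Acc.intro _ fun G hG => absurd hG.2 not_lt_bot
      · obtain ⟨N, hNc, hFN⟩ := (Submodule.fg_iff_compact F).1 hF c _ hne hchain.directedOn
          (isLUB_sSup c) hFc
        exact hc hNc F hFN hF)
  by_cases htop : N = ⊤
  · exact hN.prop F (htop ▸ le_top) hF
  -- For `x` of minimal cyclic span outside a maximal `N`, the submodule `N + Rx` still has the
  -- property defining `N`.
  exfalso
  obtain ⟨x, hxN, hmin⟩ := hR.exists_minimal_span_singleton
    (s := {z : M | z ∉ N}) (by
      by_contra h
      refine htop (eq_top_iff.2 fun z _ => ?_)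
      by_contra hz
      exact h ⟨z, hz⟩)
  have key : N ⊔ Submodule.span R {x} ≤ N := by
    refine hN.le_of_ge ?_ le_sup_left
    intro L hL hLfg
    by_cases hLN : L ≤ N
    · exact hN.prop L hLN hLfg
    obtain ⟨y, ⟨hyL, hyN⟩, hminy⟩ := hR.exists_minimal_span_singleton
      (s := {z : M | z ∈ L ∧ z ∉ N}) (Set.not_subset.1 hLN)
    -- `(N + Rx) / N` is simple, hence generated by the class of `y`.
    have hx : x ∈ Submodule.span R {y} ⊔ N := by
      obtain ⟨n, hn, a, ha, rfl⟩ := Submodule.mem_sup.1 (hL hyL)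
      have haN : a ∉ N := fun h => hyN (add_mem hn h)
      obtain ⟨s, hs⟩ := Submodule.mem_span_singleton.1 (hmin a haN ha)
      have e : x = s • (n + a) - s • n := by rw [smul_add, add_sub_cancel_left, hs]
      rw [e]
      exact sub_mem (Submodule.mem_sup_left
        (Submodule.smul_mem _ _ (Submodule.mem_span_singleton_self _)))
        (Submodule.mem_sup_right (Submodule.smul_mem _ _ hn))
    obtain ⟨F, hF, hFN, rfl⟩ := hLfg.exists_eq_span_singleton_sup hyL
      (hL.trans (sup_le le_sup_right ((Submodule.span_singleton_le_iff_mem _ _).2 hx)))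
    exact hR.acc_span_singleton_sup hN.prop (hN.prop F hFN hF) hFN y hyN
      fun z hz hzN hzy => hminy z ⟨hz, hzN⟩ hzy
  exact hxN (key (Submodule.mem_sup_right (Submodule.mem_span_singleton_self x)))

theorem IsRightPerfect.exists_succ_eq (hR : IsRightPerfect R) (L : ℕ → Submodule R M)
    (hfg : ∀ n, (L n).FG) (hL : ∀ n, L (n + 1) ≤ L n) : ∃ n, L n = L (n + 1) := by
  by_contra! h
  have hacc : ∀ F : Submodule R M, Acc (fun F G : Submodule R M => F.FG ∧ F < G) F →
      ∀ n, L n ≠ F := by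
    intro F hF
    induction hF with
    | intro F _ ih =>
      rintro n rfl
      exact ih _ ⟨hfg (n + 1), lt_of_le_of_ne (hL n) (h n).symm⟩ (n + 1) rfl
  exact hacc _ (hR.acc_of_fg (L 0) (hfg 0)) 0 rfl

end RightPerfect

/-! ### Right coideals and powers in convolution algebras -/

section Coideal

open LinearMap WithConv

variable {k : Type*} [Field k] {C : Type*} [AddCommGroup C] [Module k C] [Coalgebra k C]

variable (k) in
/-- A subspace `V` of a coalgebra `C` is a right coideal if `Δ(V) ⊆ V ⊗ C`, the latter being
the image of `V ⊗ C → C ⊗ C`. -/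
def IsRightCoideal (V : Submodule k C) : Prop :=
  ∀ x ∈ V, comul (R := k) x ∈ range (V.subtype.rTensor C)

/-- Write `Δ(y) = ∑ vᵢ ⊗ bᵢ` with the `bᵢ` in a basis of `C`; the `vᵢ` span such a right coideal. -/
theorem exists_finiteDimensional_isRightCoideal (y : C) :
    ∃ V : Submodule k C, FiniteDimensional k V ∧ y ∈ V ∧ IsRightCoideal k V := by
  classical
  let b := Module.Basis.ofVectorSpace k C
  set v := TensorProduct.equivFinsuppOfBasisRight (M := C) b (comul (R := k) y) with hv
  have hsum : comul (R := k) y = v.sum fun i m => m ⊗ₜ[k] b i := by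
    rw [← TensorProduct.equivFinsuppOfBasisRight_symm_apply, hv, LinearEquiv.symm_apply_apply]
  have hmem : ∀ i, v i ∈ Submodule.span k (v '' v.support) := by
    intro i
    by_cases hi : v i = 0
    · rw [hi]; exact zero_mem _
    · exact Submodule.subset_span ⟨i, by simpa using hi, rfl⟩
  refine ⟨Submodule.span k (v '' v.support), FiniteDimensional.span_of_finite k
    ((Finset.finite_toSet _).image _), ?_, ?_⟩
  · have h := congrArg (TensorProduct.rid k C) (Coalgebra.lTensor_counit_comul (R := k) y)
    rw [hsum] at h
    simp only [Finsupp.sum, map_sum, lTensor_tmul, TensorProduct.rid_tmul, one_smul] at h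
    rw [← h]
    exact Submodule.sum_mem _ fun i _ => Submodule.smul_mem _ _ (hmem i)
  · -- Coassociativity, `∑ Δ(v j) ⊗ b j = ∑ v j ⊗ Δ(b j)`, and the coordinate `i` of the last
    -- tensor factor.
    have hslice : ∀ i, comul (R := k) (v i) =
        ∑ j ∈ v.support, v j ⊗ₜ[k]
          (TensorProduct.rid k C (lTensor C (b.coord i) (comul (R := k) (b j)))) := by
      intro i
      have h := congrArg
        (fun t => lTensor C ((TensorProduct.rid k C).toLinearMap ∘ₗ lTensor C (b.coord i)) t)
        (Coalgebra.coassoc_apply (R := k) y)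
      rw [hsum] at h
      simp only [Finsupp.sum, map_sum, lTensor_tmul, rTensor_tmul] at h
      have e : ∀ (t : C ⊗[k] C) (c : C),
          lTensor C ((TensorProduct.rid k C).toLinearMap ∘ₗ lTensor C (b.coord i))
            (TensorProduct.assoc k C C C (t ⊗ₜ[k] c)) = b.repr c i • t := by
        intro t c
        induction t with
        | zero => simp
        | add s t hs ht => simp only [TensorProduct.add_tmul, map_add, hs, ht, smul_add]
        | tmul s t => simp
      simp only [e] at h
      refine Eq.trans ?_ h
      simp only [Module.Basis.repr_self, Finsupp.single_apply, ite_smul, one_smul, zero_smul,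
        Finset.sum_ite_eq']
      by_cases hi : v i = 0
      · simp [hi]
      · simp [hi]
    intro x hx
    refine Submodule.span_induction ?_ ?_ ?_ ?_ hx
    · rintro _ ⟨i, _, rfl⟩
      rw [hslice i]
      exact Submodule.sum_mem _ fun j _ => ⟨⟨v j, hmem j⟩ ⊗ₜ _, rfl⟩
    · rw [map_zero]; exact zero_mem _
    · intro x y _ _ hx hy
      rw [map_add]; exact add_mem hx hy
    · intro c x _ hx
      rw [map_smul]; exact Submodule.smul_mem _ _ hx

theorem IsRightCoideal.map {D : Type*} [AddCommGroup D] [Module k D] [Coalgebra k D]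
    {V : Submodule k C} (hV : IsRightCoideal k V) (q : C →ₗc[k] D) :
    IsRightCoideal k (V.map q.toLinearMap) := by
  rintro _ ⟨x, hx, rfl⟩
  obtain ⟨t, ht⟩ := hV x hx
  refine ⟨TensorProduct.map (q.toLinearMap.submoduleMap V) q.toLinearMap t, ?_⟩
  have h := LinearMap.congr_fun q.map_comp_comul x
  rw [comp_apply, comp_apply, ← ht] at h
  refine Eq.trans ?_ h
  rw [rTensor, rTensor, ← comp_apply, ← comp_apply, ← TensorProduct.map_comp,
    ← TensorProduct.map_comp]
  rfl

variable {A : Type*} [Ring A] [Algebra k A]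

theorem IsRightCoideal.convMul_eqOn {V : Submodule k C} (hV : IsRightCoideal k V)
    {h h' : WithConv (C →ₗ[k] A)} (hh : Set.EqOn h.ofConv h'.ofConv V) (f : WithConv (C →ₗ[k] A)) :
    Set.EqOn (h * f).ofConv (h' * f).ofConv V := by
  intro x hx
  obtain ⟨t, ht⟩ := hV x hx
  have e : h.ofConv ∘ₗ V.subtype = h'.ofConv ∘ₗ V.subtype := LinearMap.ext fun v => hh v.2
  have key : ∀ u : WithConv (C →ₗ[k] A), (u * f).ofConv x =
      mul' k A (TensorProduct.map (u.ofConv ∘ₗ V.subtype) f.ofConv t) := by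
    intro u
    rw [convMul_apply, ← ht, rTensor, ← comp_apply (TensorProduct.map _ _) (TensorProduct.map _ _),
      ← TensorProduct.map_comp, LinearMap.comp_id]
  rw [key, key, e]

/-- A linear map `f` from a coalgebra to a right perfect algebra satisfies `fⁿ = g * fⁿ⁺¹` for the
convolution product, locally on finite-dimensional right coideals: the subspaces `Hom(V, A) * fⁿ`
form a descending chain of finitely generated submodules of the left `A`-module `Hom(V, A)`. -/
theorem IsRightPerfect.exists_convPow_eqOn (hA : IsRightPerfect A) {V : Submodule k C}
    [FiniteDimensional k V] (hV : IsRightCoideal k V) (f : WithConv (C →ₗ[k] A)) :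
    
    ∃ (n : ℕ) (g : WithConv (C →ₗ[k] A)), Set.EqOn (f ^ n).ofConv (g * f ^ (n + 1)).ofConv V := by
  have hinj : Function.Injective (V.subtype.rTensor C) :=
    Module.Flat.rTensor_preserves_injective_linearMap _ V.subtype_injective
  -- The coaction `V → V ⊗ C`.
  let ρ : V →ₗ[k] V ⊗[k] C := (LinearEquiv.ofInjective _ hinj).symm.toLinearMap ∘ₗ
    (comul ∘ₗ V.subtype).codRestrict _ fun v => hV v v.2
  have hρ : ∀ v : V, V.subtype.rTensor C (ρ v) = comul (R := k) (v : C) := fun v =>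
    congrArg Subtype.val ((LinearEquiv.ofInjective _ hinj).apply_symm_apply ⟨_, hV v v.2⟩)
  -- Right convolution by `h` on `Hom(V, A)`, a map of left `A`-modules.
  let Ψ : WithConv (C →ₗ[k] A) → (V →ₗ[k] A) →ₗ[A] (V →ₗ[k] A) := fun h =>
    { toFun := fun g => mul' k A ∘ₗ TensorProduct.map g h.ofConv ∘ₗ ρ
      map_add' := fun g g' => by
        rw [TensorProduct.map_add_left, LinearMap.add_comp, LinearMap.comp_add]
      map_smul' := fun a g => by
        refine LinearMap.ext fun v => ?_
        change mul' k A (TensorProduct.map (a • g) h.ofConv (ρ v)) =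
          a * mul' k A (TensorProduct.map g h.ofConv (ρ v))
        induction ρ v with
        | zero => simp
        | add s t hs ht => simp only [map_add, hs, ht, mul_add]
        | tmul s t => simp [mul_assoc] }
  have hΨ : ∀ g h : WithConv (C →ₗ[k] A),
      Ψ h (g.ofConv ∘ₗ V.subtype) = (g * h).ofConv ∘ₗ V.subtype := by
    intro g h
    refine LinearMap.ext fun v => ?_
    change mul' k A (TensorProduct.map (g.ofConv ∘ₗ V.subtype) h.ofConv (ρ v)) =
      mul' k A (TensorProduct.map g.ofConv h.ofConv (comul (R := k) (v : C)))
    rw [← hρ, rTensor, ← comp_apply (TensorProduct.map _ _) (TensorProduct.map _ _),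
      ← TensorProduct.map_comp, LinearMap.comp_id]
  have hext : ∀ g : V →ₗ[k] A, ∃ g' : WithConv (C →ₗ[k] A), g'.ofConv ∘ₗ V.subtype = g := by
    intro g
    obtain ⟨g', hg'⟩ := LinearMap.exists_extend g
    exact ⟨toConv g', hg'⟩
  have hfin : (⊤ : Submodule A (V →ₗ[k] A)).FG := by
    let b := Module.finBasis k V
    refine (Submodule.fg_def).2 ⟨Set.range fun i => Algebra.linearMap k A ∘ₗ b.coord i,
      Set.finite_range _, eq_top_iff.2 fun g _ => ?_⟩
    have : g = ∑ i, g (b i) • (Algebra.linearMap k A ∘ₗ b.coord i) := by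
      refine b.ext fun j => ?_
      rw [LinearMap.sum_apply, Finset.sum_eq_single j]
      · simp
      · intro i _ hij
        simp [hij.symm]
      · simp
    rw [this]
    exact Submodule.sum_mem _ fun i _ => Submodule.smul_mem _ _ (Submodule.subset_span ⟨i, rfl⟩)
  obtain ⟨n, hn⟩ := hA.exists_succ_eq (fun n => (⊤ : Submodule A _).map (Ψ (f ^ n)))
    (fun n => hfin.map _) (by
      rintro n _ ⟨g, -, rfl⟩
      obtain ⟨g', rfl⟩ := hext g
      refine ⟨(g' * f).ofConv ∘ₗ V.subtype, trivial, ?_⟩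
      rw [hΨ, hΨ, pow_succ', mul_assoc])
  have hmem : (f ^ n).ofConv ∘ₗ V.subtype ∈ (⊤ : Submodule A _).map (Ψ (f ^ n)) :=
    ⟨(1 : WithConv (C →ₗ[k] A)).ofConv ∘ₗ V.subtype, trivial, by rw [hΨ, one_mul]⟩
  rw [hn] at hmem
  obtain ⟨g, -, hg⟩ := hmem
  obtain ⟨g', rfl⟩ := hext g
  rw [hΨ] at hg
  exact ⟨n, g', fun x hx => (LinearMap.congr_fun hg ⟨x, hx⟩).symm⟩

end Coideal

/-! ### Surjectivity of `i_B` -/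

section Surjective

open LinearMap WithConv MulOpposite

section MapConv

variable {k : Type*} [Field k] {C : Type*} [AddCommGroup C] [Module k C]
  {A A' : Type*} [Ring A] [Algebra k A] [Ring A'] [Algebra k A']

/-- Composition with an algebra map `φ : A → A'`, as a map `Hom(C, A) → Hom(C, A')` of convolution
algebras. -/
def mapConv (φ : A →ₐ[k] A') (u : WithConv (C →ₗ[k] A)) : WithConv (C →ₗ[k] A') :=
  toConv (φ.toLinearMap ∘ₗ u.ofConv)

theorem mapConv_apply (φ : A →ₐ[k] A') (u : WithConv (C →ₗ[k] A)) (c : C) :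
    (mapConv φ u).ofConv c = φ (u.ofConv c) := rfl

variable [Coalgebra k C]

theorem mapConv_mul (φ : A →ₐ[k] A') (u u' : WithConv (C →ₗ[k] A)) :
    mapConv φ (u * u') = mapConv φ u * mapConv φ u' :=
  congrArg toConv (algHom_comp_convMul_distrib _ u u')

theorem mapConv_one (φ : A →ₐ[k] A') : mapConv φ (1 : WithConv (C →ₗ[k] A)) = 1 :=
  congrArg toConv (LinearMap.ext fun _ => φ.commutes _)

variable {A'' : Type*} [Ring A''] [Algebra k A''] {O : Type*} [AddCommGroup O] [Module k O]
  {α : A →ₐ[k] A''} {β : A' →ₐ[k] A''} {p : A'' →ₗ[k] O} {i : WithConv (C →ₗ[k] A)}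
  {j : WithConv (C →ₗ[k] A')}

/-- A factor `α(i(c₁)) β(j(c₂))` in the middle of a product `α(x) β(y)` is assumed to be invisible to
the linear map `p`; so it is in the middle of the convolution product of `α u` and `β w`. -/
theorem comp_mapConv_mul_mapConv
    (hp : ∀ x y c, p (α x * (mapConv α i * mapConv β j).ofConv c * β y) =
      counit (R := k) c • p (α x * β y))
    (u : WithConv (C →ₗ[k] A)) (w : WithConv (C →ₗ[k] A')) :
    p ∘ₗ (mapConv α (u * i) * mapConv β (j * w)).ofConv =
      p ∘ₗ (mapConv α u * mapConv β w).ofConv := by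
  have h : ∀ D : WithConv (C →ₗ[k] A''), (∀ x y c, p (α x * D.ofConv c * β y) = 0) →
      p ∘ₗ (mapConv α u * D * mapConv β w).ofConv = 0 := by
    intro D hD
    refine LinearMap.ext fun b => ?_
    rw [LinearMap.comp_apply, (ℛ k b).convMul_apply, map_sum]
    refine Finset.sum_eq_zero fun i _ => ?_
    rw [(ℛ k _).convMul_apply, Finset.sum_mul, map_sum]
    exact Finset.sum_eq_zero fun j _ => hD _ _ _
  have h1 := h (mapConv α i * mapConv β j - 1) (by
    intro x y c
    have e : (mapConv α i * mapConv β j - 1).ofConv c =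
        (mapConv α i * mapConv β j).ofConv c - algebraMap k _ (counit (R := k) c) := rfl
    rw [e, mul_sub, sub_mul, map_sub, hp, ← Algebra.commutes, mul_assoc, ← Algebra.smul_def,
      map_smul, sub_self])
  rw [mul_sub, sub_mul, mul_one] at h1
  rw [mapConv_mul, mapConv_mul, ← sub_eq_zero, ← h1]
  simp only [mul_assoc]
  exact (LinearMap.comp_sub _ _ _).symm

theorem comp_mapConv_pow_mul_mapConv_pow
    (hp : ∀ x y c, p (α x * (mapConv α i * mapConv β j).ofConv c * β y) =
      counit (R := k) c • p (α x * β y))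
    (u : WithConv (C →ₗ[k] A)) (w : WithConv (C →ₗ[k] A')) (n : ℕ) :
    p ∘ₗ (mapConv α (u * i ^ n) * mapConv β (j ^ n * w)).ofConv =
      p ∘ₗ (mapConv α u * mapConv β w).ofConv := by
  induction n with
  | zero => rw [pow_zero, pow_zero, mul_one, one_mul]
  | succ n ih =>
    rw [pow_succ, ← mul_assoc, pow_succ', mul_assoc j, comp_mapConv_mul_mapConv hp, ih]

/-- If `iⁿ = g * iⁿ⁺¹` on `V` and factors `α(i(c₁)) β(j(c₂))` in the middle of a product are
invisible to `p`, then on `V`, with convolution products,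
`p(β j) = p(αiⁿ * βjⁿ⁺¹) = p(αg * αiⁿ⁺¹ * βjⁿ⁺¹) = p(α g)`. -/
theorem IsRightCoideal.map_eq_of_convPow_eqOn
    (hp : ∀ x y c, p (α x * (mapConv α i * mapConv β j).ofConv c * β y) =
      counit (R := k) c • p (α x * β y))
    {V : Submodule k C} (hV : IsRightCoideal k V) {n : ℕ} {g : WithConv (C →ₗ[k] A)}
    (hg : Set.EqOn (i ^ n).ofConv (g * i ^ (n + 1)).ofConv V) {y : C} (hy : y ∈ V) :
    p (β (j.ofConv y)) = p (α (g.ofConv y)) := by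
  have h1 := comp_mapConv_pow_mul_mapConv_pow hp 1 j n
  have h2 := comp_mapConv_pow_mul_mapConv_pow hp g 1 (n + 1)
  rw [one_mul, ← pow_succ, mapConv_one, one_mul] at h1
  rw [mul_one, mapConv_one, mul_one] at h2
  have h3 : Set.EqOn (mapConv α (i ^ n)).ofConv (mapConv α (g * i ^ (n + 1))).ofConv V :=
    fun x hx => by rw [mapConv_apply, mapConv_apply, hg hx]
  have h4 := congrArg p (hV.convMul_eqOn h3 (mapConv β (j ^ (n + 1))) hy)
  exact (LinearMap.congr_fun h1 y).symm.trans (h4.trans (LinearMap.congr_fun h2 y))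

end MapConv

variable (k : Type u) [Field k] (B : Type v) [Ring B] [Bialgebra k B]

/-- The projection `B ⊗ Bᵒᵖ → B ⊘ B`, `x ⊗ y ↦ [x ⊗ y]`. The second factor carries the opposite
multiplication, so that the diagonal right action of `b ∈ B` on `x ⊗ y` becomes the insertion of
`b₁ ⊗ b₂` in the middle of `(x ⊗ 1)(1 ⊗ y)`. -/
def opMkQ : B ⊗[k] Bᵐᵒᵖ →ₗ[k] Oslash k B :=
  (oslashRel k B).mkQ ∘ₗ (opLinearEquiv k (M := B)).symm.toLinearMap.lTensor B

variable {k B}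

/-- The invisibility of `c₁ ⊗ c₂` in the middle of `(x ⊗ 1)(1 ⊗ y)` is the defining relation of
`B ⊘ B`. -/
theorem opMkQ_includeLeft_mul_includeRight (x : B) (y : Bᵐᵒᵖ) (c : B) :
    opMkQ k B ((Algebra.TensorProduct.includeLeft : B →ₐ[k] B ⊗[k] Bᵐᵒᵖ) x *
      (mapConv Algebra.TensorProduct.includeLeft (toConv LinearMap.id) *
        mapConv Algebra.TensorProduct.includeRight
          (toConv (opLinearEquiv k (M := B)).toLinearMap)).ofConv c *
      (Algebra.TensorProduct.includeRight : Bᵐᵒᵖ →ₐ[k] B ⊗[k] Bᵐᵒᵖ) y) =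
    counit (R := k) c • opMkQ k B ((Algebra.TensorProduct.includeLeft : B →ₐ[k] B ⊗[k] Bᵐᵒᵖ) x *
      (Algebra.TensorProduct.includeRight : Bᵐᵒᵖ →ₐ[k] B ⊗[k] Bᵐᵒᵖ) y) := by
  obtain ⟨y, rfl⟩ := op_surjective y
  have e : opMkQ k B ((Algebra.TensorProduct.includeLeft : B →ₐ[k] B ⊗[k] Bᵐᵒᵖ) x *
      (Algebra.TensorProduct.includeRight : Bᵐᵒᵖ →ₐ[k] B ⊗[k] Bᵐᵒᵖ) (op y)) =
      (oslashRel k B).mkQ (x ⊗ₜ[k] y) := by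
    simp [opMkQ]
  rw [e, ← mkQ_mul_comul, (ℛ k c).convMul_apply, Finset.mul_sum, Finset.sum_mul,
    map_sum, ← (ℛ k c).eq, Finset.mul_sum, map_sum]
  refine Finset.sum_congr rfl fun i _ => ?_
  simp [opMkQ, mapConv_apply]

/-- `i_B` is left `B`-linear: `[s ⊗ 1] = [1 ⊗ y]` implies `[xs ⊗ 1] = [x ⊗ y]`. -/
theorem iMap_mul (x s y : B) (h : iMap k B s = (oslashRel k B).mkQ (1 ⊗ₜ[k] y)) :
    iMap k B (x * s) = (oslashRel k B).mkQ (x ⊗ₜ[k] y) := by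
  have h' := mul_mem_oslashRel (x ⊗ₜ[k] (1 : B))
    ((Submodule.Quotient.eq _).1 (show (oslashRel k B).mkQ (s ⊗ₜ[k] 1) = _ from h))
  rw [mul_sub] at h'
  simpa [iMap] using (Submodule.Quotient.eq _).2 h'

/-- Right perfectness gives `idⁿ = g * idⁿ⁺¹` near `y`, and then
`[1 ⊗ y] = [y₁⋯yₙ ⊗ y₂ₙ₊₁⋯yₙ₊₁] = [g(y₁) y₂⋯yₙ₊₂ ⊗ y₂ₙ₊₃⋯yₙ₊₃] = [g(y) ⊗ 1]`. -/
theorem IsRightPerfect.iMap_surjective (hB : IsRightPerfect B) :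
    Function.Surjective (iMap k B) := by
  have hy : ∀ y : B, ∃ s : B, iMap k B s = (oslashRel k B).mkQ (1 ⊗ₜ[k] y) := by
    intro y
    obtain ⟨V, _, hyV, hV⟩ := exists_finiteDimensional_isRightCoideal (k := k) y
    obtain ⟨n, g, hg⟩ := hB.exists_convPow_eqOn hV (toConv (LinearMap.id (R := k) (M := B)))
    exact ⟨g.ofConv y,
      (hV.map_eq_of_convPow_eqOn opMkQ_includeLeft_mul_includeRight hg hyV).symm⟩
  intro z
  obtain ⟨z, rfl⟩ := (oslashRel k B).mkQ_surjective z
  induction z with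
  | zero => exact ⟨0, by simp⟩
  | add s t hs ht =>
    obtain ⟨a, ha⟩ := hs
    obtain ⟨b, hb⟩ := ht
    exact ⟨a + b, by rw [map_add, map_add, ha, hb]⟩
  | tmul x y =>
    obtain ⟨s, hs⟩ := hy y
    exact ⟨x * s, iMap_mul x s y hs⟩

end Surjective

/-! ### The antipode of `Q(B)` -/

section Antipode

open LinearMap WithConv

variable {k : Type u} [Field k] {B : Type v} [Ring B] [Bialgebra k B]

theorem qMap_surjective : Function.Surjective (qMap k B) := Ideal.Quotient.mk_surjective

theorem qMap_eq_zero_iff {x : B} : qMap k B x = 0 ↔ x ∈ kerIdeal k B :=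
  Ideal.Quotient.eq_zero_iff_mem

theorem qMap_eq_zero_of_mem_ker_iMap {x : B} (hx : x ∈ LinearMap.ker (iMap k B)) :
    qMap k B x = 0 := by
  rw [qMap_eq_zero_iff, mem_kerIdeal, ← mul_one x]
  exact Submodule.mul_mem_mul hx Submodule.mem_top

/-- If `i_B` is onto, then `q_B` has the right convolution inverse `y ↦ q_B(s)`, where `s` is
determined up to `ker(i_B)` by `[s ⊗ 1] = [1 ⊗ y]`. -/
theorem exists_qMap_convMul_eq_one (hi : Function.Surjective (iMap k B)) :
    ∃ S : WithConv (B →ₗ[k] QBialg k B), toConv (qMap k B : B →ₗ[k] QBialg k B) * S = 1 := by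
  obtain ⟨σ, hσ⟩ := (iMap k B).exists_rightInverse_of_surjective (LinearMap.range_eq_top.2 hi)
  have hσ' : ∀ z, iMap k B (σ z) = z := LinearMap.congr_fun hσ
  have hq : ∀ x, qMap k B (σ (iMap k B x)) = qMap k B x := by
    intro x
    rw [← sub_eq_zero, ← map_sub]
    exact qMap_eq_zero_of_mem_ker_iMap (by rw [LinearMap.mem_ker, map_sub, hσ', sub_self])
  refine ⟨toConv ((qMap k B : B →ₗ[k] QBialg k B) ∘ₗ σ ∘ₗ (oslashRel k B).mkQ ∘ₗ
    TensorProduct.mk k B B 1), ?_⟩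
  have key : ∀ x y, qMap k B x * qMap k B (σ ((oslashRel k B).mkQ (1 ⊗ₜ[k] y))) =
      qMap k B (σ ((oslashRel k B).mkQ (x ⊗ₜ[k] y))) := by
    intro x y
    rw [← map_mul, ← iMap_mul x _ y (hσ' _), hq]
  refine congrArg toConv (LinearMap.ext fun b => ?_)
  have h := mkQ_mul_comul (k := k) (1 : B ⊗[k] B) b
  rw [one_mul] at h
  change mul' k _ (TensorProduct.map _ _ (comul (R := k) b)) =
    algebraMap k (QBialg k B) (counit (R := k) b)
  have h2 : ∀ t : B ⊗[k] B, mul' k _ (TensorProduct.map (qMap k B : B →ₗ[k] QBialg k B)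
      ((qMap k B : B →ₗ[k] QBialg k B) ∘ₗ σ ∘ₗ (oslashRel k B).mkQ ∘ₗ
        TensorProduct.mk k B B 1) t) = qMap k B (σ ((oslashRel k B).mkQ t)) := by
    intro t
    induction t with
    | zero => simp
    | add s t hs ht => simp only [map_add, hs, ht]
    | tmul x y => exact key x y
  refine (h2 _).trans ?_
  have h1 : (oslashRel k B).mkQ (1 : B ⊗[k] B) = iMap k B 1 := rfl
  rw [h, h1, map_smul, map_smul, hq, map_one, Algebra.algebraMap_eq_smul_one]

/-- Right perfectness makes a right convolution inverse `S` of a surjective bialgebra map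
`q : B → Q` descend to an antipode of `Q`: near `b ∈ B` one has `idⁿ = g * idⁿ⁺¹` on `Q`, hence
`qⁿ = (g ∘ q) * qⁿ⁺¹`, and multiplication by powers of `S` gives `1 = (g ∘ q) * q` and
`S = g ∘ q`. -/
theorem IsRightPerfect.exists_isAntipode {Q : Type*} [Ring Q] [Bialgebra k Q]
    (hQ : IsRightPerfect Q) (q : B →ₐc[k] Q) (hq : Function.Surjective q)
    {S : WithConv (B →ₗ[k] Q)} (hS : toConv (q : B →ₗ[k] Q) * S = 1) :
    ∃ S' : Q →ₗ[k] Q, IsAntipode k S' := by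
  set q' : WithConv (B →ₗ[k] Q) := toConv (q : B →ₗ[k] Q) with hq'
  have hcomp : ∀ (g h : WithConv (Q →ₗ[k] Q)),
      toConv ((g * h).ofConv ∘ₗ (q : B →ₗ[k] Q)) =
        toConv (g.ofConv ∘ₗ (q : B →ₗ[k] Q)) * toConv (h.ofConv ∘ₗ (q : B →ₗ[k] Q)) :=
    fun g h => congrArg toConv (convMul_comp_coalgHom_distrib g h (q : B →ₗc[k] Q))
  have hone : toConv ((1 : WithConv (Q →ₗ[k] Q)).ofConv ∘ₗ (q : B →ₗ[k] Q)) = 1 :=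
    congrArg toConv (LinearMap.ext fun b =>
      congrArg (algebraMap k Q) (CoalgHomClass.counit_comp_apply q b))
  have hpow : ∀ n : ℕ, toConv ((toConv (LinearMap.id (R := k) (M := Q)) ^ n).ofConv ∘ₗ
      (q : B →ₗ[k] Q)) = q' ^ n := by
    intro n
    induction n with
    | zero => exact hone
    | succ n ih => rw [pow_succ, hcomp, ih, pow_succ]; rfl
  have hloc : ∀ b : B, ∃ g : Q →ₗ[k] Q, S.ofConv b = g (q b) ∧
      (S * q').ofConv b = (1 : WithConv (B →ₗ[k] Q)).ofConv b := by
    intro b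
    obtain ⟨V, _, hbV, hV⟩ := exists_finiteDimensional_isRightCoideal (k := k) b
    obtain ⟨n, g, hg⟩ := hQ.exists_convPow_eqOn (hV.map (q : B →ₗc[k] Q))
      (toConv (LinearMap.id (R := k) (M := Q)))
    set g' : WithConv (B →ₗ[k] Q) := toConv (g.ofConv ∘ₗ (q : B →ₗ[k] Q)) with hg'
    have h1 : Set.EqOn (q' ^ n).ofConv (g' * q' ^ (n + 1)).ofConv V := by
      rw [← hpow, ← hpow, hg', ← hcomp]
      exact fun x hx => hg ⟨x, hx, rfl⟩
    have h2 := hV.convMul_eqOn h1 (S ^ n)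
    rw [pow_succ', mul_assoc, mul_assoc, pow_mul_pow_eq_one n hS, mul_one] at h2
    have h3 := hV.convMul_eqOn h2 S
    rw [one_mul, mul_assoc, hS, mul_one] at h3
    refine ⟨g.ofConv, h3 hbV, ?_⟩
    rw [hV.convMul_eqOn h3 q' hbV, h2 hbV]
  obtain ⟨σ, hσ⟩ := (q : B →ₗ[k] Q).exists_rightInverse_of_surjective (LinearMap.range_eq_top.2 hq)
  have hSσ : toConv ((S.ofConv ∘ₗ σ) ∘ₗ (q : B →ₗ[k] Q)) = S := by
    refine congrArg toConv (LinearMap.ext fun b => ?_)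
    rw [← sub_eq_zero]
    change S.ofConv (σ (q b)) - S.ofConv b = 0
    rw [← map_sub]
    obtain ⟨g, hg, -⟩ := hloc (σ (q b) - b)
    have : q (σ (q b)) = q b := LinearMap.congr_fun hσ (q b)
    rw [hg, map_sub, this, sub_self, map_zero]
  have hSq : S * q' = 1 := congrArg toConv (LinearMap.ext fun b => (hloc b).choose_spec.2)
  -- Composition with the surjective `q` is injective, so identities may be checked on `B`.
  have hcancel : ∀ g : WithConv (Q →ₗ[k] Q), toConv (g.ofConv ∘ₗ (q : B →ₗ[k] Q)) = 1 → g = 1 := by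
    intro g hg
    rw [← hone] at hg
    refine congrArg toConv (LinearMap.ext fun x => ?_)
    obtain ⟨b, rfl⟩ := hq x
    exact LinearMap.congr_fun (congrArg ofConv hg) b
  refine ⟨S.ofConv ∘ₗ σ, congrArg ofConv (hcancel (toConv (S.ofConv ∘ₗ σ) * toConv LinearMap.id) ?_),
    congrArg ofConv (hcancel (toConv LinearMap.id * toConv (S.ofConv ∘ₗ σ)) ?_)⟩
  · rw [hcomp]
    exact (congrArg (· * q') hSσ).trans hSq
  · rw [hcomp]
    exact (congrArg (q' * ·) hSσ).trans hS

end Antipode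

/-! ### The universal property -/

section UniversalProperty

open LinearMap WithConv

variable {k : Type u} [Field k]

/-- A bialgebra map to a Hopf algebra commutes with antipodes: both sides are convolution inverses
of `g`. -/
theorem IsAntipode.map_eq_antipode_map {H : Type*} [Ring H] [Bialgebra k H] {S : H →ₗ[k] H}
    (hS : IsAntipode k S) {L : Type*} [Ring L] [HopfAlgebra k L] (g : H →ₐc[k] L) (x : H) :
    g (S x) = HopfAlgebra.antipode k (g x) := by
  have h1 : toConv ((g : H →ₗ[k] L) ∘ₗ S) * toConv (g : H →ₗ[k] L) = 1 := by
    have h := algHom_comp_convMul_distrib (g : H →ₐ[k] L) (toConv S) (toConv LinearMap.id)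
    have e : toConv S * toConv LinearMap.id = 1 := congrArg toConv hS.1
    rw [e] at h
    exact (congrArg toConv h).symm.trans (mapConv_one (g : H →ₐ[k] L))
  have h2 : toConv (g : H →ₗ[k] L) * toConv (HopfAlgebra.antipode k ∘ₗ (g : H →ₗ[k] L)) = 1 := by
    have h := convMul_comp_coalgHom_distrib (toConv LinearMap.id)
      (toConv (HopfAlgebra.antipode k (A := L))) (g : H →ₗc[k] L)
    rw [id_mul_antipode] at h
    refine (congrArg toConv h).symm.trans (congrArg toConv (LinearMap.ext fun b => ?_))
    exact congrArg (algebraMap k L) (CoalgHomClass.counit_comp_apply g b)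
  exact LinearMap.congr_fun (congrArg ofConv (left_inv_eq_right_inv h1 h2)) x

variable {B : Type v} [Ring B] [Bialgebra k B] {L : Type w} [Ring L] [HopfAlgebra k L]

/-- The map `x ⊗ y ↦ f(x) S(f(y))` vanishes on `(B ⊗ B) B⁺`, and it maps `x ⊗ 1` to `f(x)`. -/
theorem map_eq_zero_of_mem_ker_iMap (f : B →ₐc[k] L) {x : B} (hx : x ∈ LinearMap.ker (iMap k B)) :
    f x = 0 := by
  let θ : B ⊗[k] B →ₗ[k] L := mul' k L ∘ₗ
    TensorProduct.map (f : B →ₗ[k] L) (HopfAlgebra.antipode k ∘ₗ (f : B →ₗ[k] L))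
  have hθt : ∀ x y, θ (x ⊗ₜ[k] y) = f x * HopfAlgebra.antipode k (f y) := fun _ _ => rfl
  have hθ1 : ∀ b : B, θ (comul (R := k) b) = algebraMap k L (counit (R := k) b) := by
    intro b
    have h := HopfAlgebra.mul_antipode_lTensor_comul_apply (R := k) (f b)
    rw [CoalgHomClass.counit_comp_apply, ← CoalgHomClass.map_comp_comul_apply] at h
    rw [← h]
    generalize comul (R := k) b = t
    induction t with
    | zero => simp
    | add s t hs ht => simp only [map_add, hs, ht]
    | tmul x y => simp [hθt]
  have hθ : ∀ (x y : B) (t : B ⊗[k] B),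
      θ ((x ⊗ₜ[k] y) * t) = f x * θ t * HopfAlgebra.antipode k (f y) := by
    intro x y t
    induction t with
    | zero => simp
    | add s t hs ht => simp only [map_add, mul_add, add_mul, hs, ht]
    | tmul a b =>
      rw [Algebra.TensorProduct.tmul_mul_tmul, hθt, hθt, map_mul, map_mul,
        HopfAlgebra.antipode_mul_antidistrib]
      simp only [mul_assoc]
  have h0 : ∀ z ∈ oslashRel k B, θ z = 0 := by
    intro z hz
    refine Submodule.span_induction ?_ ?_ ?_ ?_ hz
    · rintro _ ⟨t, b, hb, rfl⟩
      induction t with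
      | zero => simp
      | add s t hs ht => rw [add_mul, map_add, hs, ht, add_zero]
      | tmul x y => rw [hθ, hθ1, hb, map_zero, mul_zero, zero_mul]
    · simp
    · intro x y _ _ hx hy
      rw [map_add, hx, hy, add_zero]
    · intro c x _ hx
      rw [map_smul, hx, smul_zero]
  have h1 : x ⊗ₜ[k] (1 : B) ∈ oslashRel k B := by
    simpa [iMap] using hx
  simpa [hθt, HopfAlgebra.antipode_one] using h0 _ h1

theorem exists_comp_qMap_eq (f : B →ₐc[k] L) :
    ∃ g : QBialg k B →ₐc[k] L, g.comp (qMap k B) = f := by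
  have hf : ∀ x ∈ kerIdeal k B, (f : B →ₐ[k] L) x = 0 := by
    intro x hx
    refine Submodule.mul_induction_on (mem_kerIdeal.1 hx) ?_ ?_
    · intro m hm n _
      rw [map_mul]
      change f m * _ = 0
      rw [map_eq_zero_of_mem_ker_iMap f hm, zero_mul]
    · intro x y hx hy
      rw [map_add, hx, hy, add_zero]
  let g : QBialg k B →ₐ[k] L := Ideal.Quotient.liftₐ (kerIdeal k B) (f : B →ₐ[k] L) hf
  have hg : ∀ b, g (qMap k B b) = f b := fun _ => rfl
  refine ⟨BialgHom.ofAlgHom g ?_ ?_, ?_⟩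
  · refine AlgHom.ext fun x => ?_
    obtain ⟨b, rfl⟩ := qMap_surjective x
    exact CoalgHomClass.counit_comp_apply f b
  · refine AlgHom.ext fun x => ?_
    obtain ⟨b, rfl⟩ := qMap_surjective x
    change TensorProduct.map g.toLinearMap g.toLinearMap (TensorProduct.map
      (Ideal.Quotient.mkₐ k (kerIdeal k B)).toLinearMap
      (Ideal.Quotient.mkₐ k (kerIdeal k B)).toLinearMap (comul b)) = comul (f b)
    rw [← CoalgHomClass.map_comp_comul_apply, ← LinearMap.comp_apply, ← TensorProduct.map_comp]
    rfl
  · exact BialgHom.ext fun b => hg b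

end UniversalProperty

/-! ### The Hopf envelope of a right perfect bialgebra -/

theorem mainTheorem2 (k : Type u) [Field k] (B : Type v) [Ring B] [Bialgebra k B]
    (hB : IsRightPerfect B) :
    IsHopfEnvelope.{u, v, v, w} k (qMap k B) := by
  obtain ⟨S, hS⟩ := exists_qMap_convMul_eq_one (k := k) hB.iMap_surjective
  have hQ : IsRightPerfect (QBialg k B) :=
    hB.of_surjective (Ideal.Quotient.mk (kerIdeal k B)) Ideal.Quotient.mk_surjective
  obtain ⟨S', hS'⟩ := hQ.exists_isAntipode (qMap k B) qMap_surjective hS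
  refine ⟨S', hS', fun L _ _ f => ?_⟩
  obtain ⟨g, hg⟩ := exists_comp_qMap_eq f
  refine ⟨g, ⟨fun x => hS'.map_eq_antipode_map g x, hg⟩, fun g' hg' => BialgHom.ext fun x => ?_⟩
  obtain ⟨b, rfl⟩ := qMap_surjective x
  exact DFunLike.congr_fun (hg'.2.trans hg.symm) b
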